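/- Consider the 3-chain (bilocality) scenario with binary variables: Alice, Bob and Charlie have outputs $a,b,c\in\{0,1\}$, Alice and Charlie have inputs $x,z\in\{0,1\}$, Bob has no input; one source is shared by Alice and Bob, an independent one by Bob and Charlie. For correlations $p(a,b,c|x,z)$ define: * $\mathcal S_0$ (both sources classical): $p(a,b,c|x,z)=\int\!\!\int p_A(a|x,\lambda_1)\,p_B(b|\lambda_1,\lambda_2)\,p_C(c|z,\lambda_2)\,d\mu_1(\lambda_1)\,d\mu_2(\lambda_2)$ for probability measures $\mu_1,\mu_2$ and conditional probabilities $p_A,p_B,p_C$. * $\mathcal S_1^{[AB^OBC^L]}$: $p(a,b,c|x,z)=\int p_{AB}(a,b|x,\lambda)\,p_C(c|z,\lambda)\,d\mu(\lambda)$ for a probability measure $\mu$, a conditional probability $p_C$ and a bipartite no-signalling box $p_{AB}$ with inputs $x$ (Alice) and $\lambda$ (Bob). * $\mathcal S_1^{[AB^LBC^O]}$: $p(a,b,c|x,z)=\int p_A(a|x,\lambda)\,p_{BC}(b,c|\lambda,z)\,d\mu(\lambda)$ for a probability measure $\mu$, a conditional probability $p_A$ and a bipartite no-signalling box $p_{BC}$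 with inputs $\lambda$ (Bob) and $z$ (Charlie). * $\mathcal S_1^{\cap}=\mathcal S_1^{[AB^OBC^L]}\cap\mathcal S_1^{[AB^LBC^O]}$; the correlations in $\mathcal S_1^{\cap}\setminus\mathcal S_0$ are called minimally network nonclassical (MNN). * $\mathcal Q_2$ (quantumly realizable): $p(a,b,c|x,z)=\mathrm{Tr}\big[(\rho_{AB}\otimes\sigma_{B'C})(A_{a|x}\otimes B_b\otimes C_{c|z})\big]$ for density matrices $\rho_{AB}$, $\sigma_{B'C}$ on finite-dimensional spaces and POVMs $\{A_{a|x}\}_a$ on $A$, $\{B_b\}_b$ on $BB'$, $\{C_{c|z}\}_c$ on $C$. Let $|\phi^+\rangle=(|00\rangle+|11\rangle)/\sqrt2$ and $|\psi^+\rangle=(|01\rangle+|10\rangle)/\sqrt2$; for an observable with values $\pm1$, outcome $o$ stands for the value $(-1)^o$. * Let $p_{ES}$ be the correlation obtained when both sources emit $|\phi^+\rangle$, Alice measures $(\sigma_x-\sigma_z)/\sqrt2$ for $x=0$ and $(\sigma_x+\sigma_z)/\sqrt2$ for $x=1$, Charlie measures $\sigma_x$ for $z=0$ and $\sigma_z$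 for $z=1$, and Bob's measurement operators are $B_0=|\psi^+\rangle\langle\psi^+|$, $B_1=\mathbb 1-B_0$. * Let $p_L(a,b,c|x,z)=\tfrac12\,q(a,b|x,c)$, where $q(a,b|x,c)=\tfrac14$ if $x\ne c$, $q(a,b|x,c)=\tfrac12$ if $x=c$ and $a=b$, and $q(a,b|x,c)=0$ if $x=c$ and $a\neq b$. * For $\theta\in\mathbb R$ let $p^{(2)}_\theta$ be the correlation obtained when both sources emit $|\phi^+\rangle$, Alice and Charlie each measure $\sigma_x$ on input $0$ and $\sigma_z$ on input $1$, and Bob's measurement operators are $B_0=|\psi_\theta\rangle\langle\psi_\theta|$, $B_1=\mathbb 1-B_0$, where $|\psi_\theta\rangle=\sin\theta|01\rangle+\cos\theta|10\rangle$, the first qubit coming from the source shared with Alice. Then there are quantumly realizable MNN correlations, that is, $\mathcal Q_2\cap(\mathcal S_1^{\cap}\setminus\mathcal S_0)\neq\emptyset$. More precisely: 1. $p_{ES}(a,0,c|x,z)=\tfrac1{4}\cdot\tfrac14\big(1+\tfrac1{\sqrt2}(-1)^{a+c+xz}\big)$ and $p_{ES}(a,1,c|x,z)=\tfrac14-p_{ES}(a,0,c|x,z)$,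 and for every $\mu\in(0.455,0.705)$ the mixture $\mu\,p_{ES}+(1-\mu)\,p_L$ belongs to $\mathcal Q_2\cap(\mathcal S_1^{\cap}\setminus\mathcal S_0)$. 2. For every $\theta\in(0,\pi/4)\cup(\pi/4,\pi/2)$ the correlation $p^{(2)}_\theta$ belongs to $\mathcal Q_2\cap(\mathcal S_1^{\cap}\setminus\mathcal S_0)$. -/

import Mathlib

open MeasureTheory
open scoped Kronecker ComplexOrder

namespace ThreeChain

noncomputable section

/-- The common alphabet of all inputs and outputs. -/
abbrev Bit : Type := Fin 2

/-- A table of reals `p a b c x z`, read as `p(a,b,c|x,z)`: outputs `a`, `b`, `c` of Alice, Bob and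
Charlie, inputs `x`, `z` of Alice and Charlie; Bob has no input. -/
abbrev Corr : Type := Bit → Bit → Bit → Bit → Bit → ℝ

/-! ### Classical and no-signalling models -/

/-- `r o l` is a measurable conditional probability of the output `o` given the value `l` of a
classical hidden variable. -/
def IsResponse {O Λ : Type} [Fintype O] [MeasurableSpace Λ] (r : O → Λ → ℝ) : Prop :=
  (∀ o, Measurable (r o)) ∧ (∀ o l, 0 ≤ r o l) ∧ ∀ l, ∑ o, r o l = 1

/-- `N o₁ o₂ i₁ i₂`, read as `N(o₁,o₂|i₁,i₂)`, is a bipartite no-signalling box. -/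
def IsNoSignallingBox {O₁ O₂ I₁ I₂ : Type} [Fintype O₁] [Fintype O₂]
    (N : O₁ → O₂ → I₁ → I₂ → ℝ) : Prop :=
  (∀ o₁ o₂ i₁ i₂, 0 ≤ N o₁ o₂ i₁ i₂) ∧
  (∀ i₁ i₂, ∑ o₁, ∑ o₂, N o₁ o₂ i₁ i₂ = 1) ∧
  (∀ o₁ i₁ i₂ i₂', ∑ o₂, N o₁ o₂ i₁ i₂ = ∑ o₂, N o₁ o₂ i₁ i₂') ∧
  (∀ o₂ i₁ i₁' i₂, ∑ o₁, N o₁ o₂ i₁ i₂ = ∑ o₁, N o₁ o₂ i₁' i₂)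

/-- `𝒮₀`: both sources are classical (bilocal correlations). -/
def S0 : Set Corr :=
  {p | ∃ (Λ₁ Λ₂ : Type) (_ : MeasurableSpace Λ₁) (_ : MeasurableSpace Λ₂)
      (μ₁ : Measure Λ₁) (μ₂ : Measure Λ₂)
      (pA : Bit → Bit → Λ₁ → ℝ) (pB : Bit → Λ₁ × Λ₂ → ℝ) (pC : Bit → Bit → Λ₂ → ℝ),
      IsProbabilityMeasure μ₁ ∧ IsProbabilityMeasure μ₂ ∧
      (∀ x, IsResponse fun a => pA a x) ∧ IsResponse pB ∧ (∀ z, IsResponse fun c => pC c z) ∧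
      ∀ a b c x z, p a b c x z =
        ∫ l₁, ∫ l₂, pA a x l₁ * pB b (l₁, l₂) * pC c z l₂ ∂μ₂ ∂μ₁}

/-- `𝒮₁` with a no-signalling (OPT) source between Alice and Bob and a classical source between Bob
and Charlie; the value of the classical source is Bob's input to the no-signalling box. -/
def S1_ABO_BCL : Set Corr :=
  {p | ∃ (Λ : Type) (_ : MeasurableSpace Λ) (μ : Measure Λ)
      (N : Bit → Bit → Bit → Λ → ℝ) (pC : Bit → Bit → Λ → ℝ),
      IsProbabilityMeasure μ ∧
      (∀ a b x, Measurable (N a b x)) ∧ IsNoSignallingBox N ∧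
      (∀ z, IsResponse fun c => pC c z) ∧
      ∀ a b c x z, p a b c x z = ∫ l, N a b x l * pC c z l ∂μ}

/-- `𝒮₁` with a classical source between Alice and Bob and a no-signalling (OPT) source between Bob
and Charlie; the value of the classical source is Bob's input to the no-signalling box. -/
def S1_ABL_BCO : Set Corr :=
  {p | ∃ (Λ : Type) (_ : MeasurableSpace Λ) (μ : Measure Λ)
      (pA : Bit → Bit → Λ → ℝ) (N : Bit → Bit → Λ → Bit → ℝ),
      IsProbabilityMeasure μ ∧
      (∀ x, IsResponse fun a => pA a x) ∧
      (∀ b c z, Measurable fun l => N b c l z) ∧ IsNoSignallingBox N ∧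
      ∀ a b c x z, p a b c x z = ∫ l, pA a x l * N b c l z ∂μ}

/-- `𝒮₁^∩`. -/
def S1cap : Set Corr := S1_ABO_BCL ∩ S1_ABL_BCO

/-- The minimally network nonclassical correlations. -/
def MNN : Set Corr := S1cap \ S0

/-! ### Quantum models -/

/-- Density matrices. -/
def IsState {n : Type} [Fintype n] (ρ : Matrix n n ℂ) : Prop :=
  ρ.PosSemidef ∧ ρ.trace = 1

/-- Two-outcome POVMs. -/
def IsPOVM {n : Type} [Fintype n] [DecidableEq n] (M : Bit → Matrix n n ℂ) : Prop :=
  (∀ o, (M o).PosSemidef) ∧ ∑ o, M o = 1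

/-- Born rule for two independent sources: `ρ` is the state of Alice and Bob, `σ` the state of Bob
and Charlie, `A a x`, `B b`, `C c z` are the measurement operators, and the value is
`Tr[(ρ ⊗ σ) (A a x ⊗ B b ⊗ C c z)]`. The `submatrix` only rebrackets tensor factors. -/
def bornCorr {hA hB hB' hC : Type} [Fintype hA] [Fintype hB] [Fintype hB'] [Fintype hC]
    (ρ : Matrix (hA × hB) (hA × hB) ℂ) (σ : Matrix (hB' × hC) (hB' × hC) ℂ)
    (A : Bit → Bit → Matrix hA hA ℂ) (B : Bit → Matrix (hB × hB') (hB × hB') ℂ)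
    (C : Bit → Bit → Matrix hC hC ℂ) : Corr :=
  fun a b c x z =>
    (((ρ ⊗ₖ σ) * ((A a x ⊗ₖ B b) ⊗ₖ C c z).submatrix
      (fun i : (hA × hB) × (hB' × hC) => ((i.1.1, (i.1.2, i.2.1)), i.2.2))
      (fun i : (hA × hB) × (hB' × hC) => ((i.1.1, (i.1.2, i.2.1)), i.2.2))).trace).re

/-- `𝒬₂`: correlations realizable with two independent (finite-dimensional) quantum sources. -/
def Q2 : Set Corr :=
  {p | ∃ (hA hB hB' hC : Type) (_ : Fintype hA) (_ : Fintype hB) (_ : Fintype hB')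
      (_ : Fintype hC) (_ : DecidableEq hA) (_ : DecidableEq hB) (_ : DecidableEq hB')
      (_ : DecidableEq hC)
      (ρ : Matrix (hA × hB) (hA × hB) ℂ) (σ : Matrix (hB' × hC) (hB' × hC) ℂ)
      (A : Bit → Bit → Matrix hA hA ℂ) (B : Bit → Matrix (hB × hB') (hB × hB') ℂ)
      (C : Bit → Bit → Matrix hC hC ℂ),
      IsState ρ ∧ IsState σ ∧ (∀ x, IsPOVM fun a => A a x) ∧ IsPOVM B ∧
      (∀ z, IsPOVM fun c => C c z) ∧ p = bornCorr ρ σ A B C}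

/-! ### The two families of examples -/

def sigmaX : Matrix Bit Bit ℂ := !![0, 1; 1, 0]

def sigmaZ : Matrix Bit Bit ℂ := !![1, 0; 0, -1]

/-- The rank-one operator `|v⟩⟨v|`. -/
def ketbra {n : Type} (v : n → ℂ) : Matrix n n ℂ := Matrix.vecMulVec v (star v)

/-- Spectral projector of a `±1`-valued observable `O`; outcome `o` stands for the value `(-1)^o`. -/
def obsProj (O : Matrix Bit Bit ℂ) (o : Bit) : Matrix Bit Bit ℂ :=
  (1 / 2 : ℂ) • (1 + (-1 : ℂ) ^ o.val • O)

/-- The measurement `{|v⟩⟨v|, 1 - |v⟩⟨v|}`, with outcome `0` for `|v⟩⟨v|`. -/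
def vecMeas {n : Type} [DecidableEq n] (v : n → ℂ) (b : Bit) : Matrix n n ℂ :=
  if b = 0 then ketbra v else 1 - ketbra v

/-- `|φ⁺⟩ = (|00⟩ + |11⟩)/√2`. -/
def phiPlus : Bit × Bit → ℂ := fun i => if i.1 = i.2 then ((1 / √2 : ℝ) : ℂ) else 0

/-- `|ψ⁺⟩ = (|01⟩ + |10⟩)/√2`. -/
def psiPlus : Bit × Bit → ℂ := fun i => if i.1 = i.2 then 0 else ((1 / √2 : ℝ) : ℂ)

/-- `|ψ_θ⟩ = sin θ |01⟩ + cos θ |10⟩`. -/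
def psiTheta (θ : ℝ) : Bit × Bit → ℂ := fun i =>
  if i = (0, 1) then (Real.sin θ : ℂ) else if i = (1, 0) then (Real.cos θ : ℂ) else 0

/-- The observables `(σ_x - σ_z)/√2` (input `0`) and `(σ_x + σ_z)/√2` (input `1`). -/
def obsDiag (x : Bit) : Matrix Bit Bit ℂ :=
  ((1 / √2 : ℝ) : ℂ) • (if x = 0 then sigmaX - sigmaZ else sigmaX + sigmaZ)

/-- The observables `σ_x` (input `0`) and `σ_z` (input `1`). -/
def obsXZ (x : Bit) : Matrix Bit Bit ℂ := if x = 0 then sigmaX else sigmaZ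

/-- The entanglement-swapping correlation: both sources emit `|φ⁺⟩`, Bob tests for `|ψ⁺⟩`. -/
def pES : Corr :=
  bornCorr (ketbra phiPlus) (ketbra phiPlus) (fun a x => obsProj (obsDiag x) a)
    (vecMeas psiPlus) (fun c z => obsProj (obsXZ z) c)

/-- The noisy Popescu–Rohrlich box `(1 + V (-1)^(a + c + x z)) / 4`. -/
def prBox (V : ℝ) (a c x z : Bit) : ℝ :=
  (1 + V * (-1) ^ (a.val + c.val + x.val * z.val)) / 4

/-- The post-selection box with visibility `V` and post-selection probability `q`. -/
def pPS (V q : ℝ) : Corr := fun a b c x z =>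
  if b = 0 then q * prBox V a c x z else 1 / 4 - q * prBox V a c x z

/-- The local Bell test: Charlie outputs a uniform bit `c`, which is also Bob's setting. -/
def pL : Corr := fun a b c x _ =>
  1 / 2 * (if x = c then (if a = b then 1 / 2 else 0) else 1 / 4)

/-- The mixture of entanglement swapping and the local Bell test. -/
def pMNN1 (μ : ℝ) : Corr := μ • pES + (1 - μ) • pL

/-- Both sources emit `|φ⁺⟩`, Bob tests for `|ψ_θ⟩`, Alice and Charlie measure `σ_x` or `σ_z`. -/
def pMNN2 (θ : ℝ) : Corr :=
  bornCorr (ketbra phiPlus) (ketbra phiPlus) (fun a x => obsProj (obsXZ x) a)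
    (vecMeas (psiTheta θ)) (fun c z => obsProj (obsXZ z) c)

end

end ThreeChain

/-!
Classical sources that reproduce uniform outputs of Alice and Charlie distribute deterministic
strategies with weights determined by a single parameter each, `u` for Alice and `v` for Charlie.
Bob's output `0` selects a subweight of the product of these weights. Hardy-type inequalities bound
entries of this subweight from below by the observed probabilities, while the product structure
bounds them from above by `u (1/2 - v)` and `(1/2 - u) v`; these bounds are incompatible, so the
correlations are not in `S0`.

For membership in `S1cap`, the classical source sends a uniformly random deterministic strategy to
Charlie and to Bob, who uses it as his input to a no-signalling box with uniform marginals shared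
with Alice. The correlations obtained in this way form a convex set, so only the vertices of the
triangle of mixtures need explicit boxes. Exchanging Alice and Charlie gives the other scenario.

For `Q2`, the set of correlations realizable with a fixed source and fixed measurements on Alice's
side is convex, since the other source can carry a flag. It contains `pES`, and also `pL`, which is
a mixture of two local Bell tests between Alice and Bob.
-/

namespace ThreeChain

noncomputable section

open Finset

/-- A deterministic strategy of a party with a binary input is the pair `l` of its answers to the
inputs `0` and `1`; `answer l i` is its answer to the input `i`. -/
def answer (l : Bit × Bit) (i : Bit) : Bit := if i = 0 then l.1 else l.2

lemma sum_answer_zero_eq (f : Bit × Bit → ℝ) (o : Bit) :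
    ∑ l with answer l 0 = o, f l = f (o, 0) + f (o, 1) := by
  fin_cases o <;> simp [answer, sum_filter, Fintype.sum_prod_type]

lemma sum_answer_one_eq (f : Bit × Bit → ℝ) (o : Bit) :
    ∑ l with answer l 1 = o, f l = f (0, o) + f (1, o) := by
  fin_cases o <;> simp [answer, sum_filter, Fintype.sum_prod_type]

/-- The two-party correlation obtained from (unnormalised) weights `G` on pairs of deterministic
strategies of Alice and Charlie. -/
def strategyMixture (G : Bit × Bit → Bit × Bit → ℝ) (a c x z : Bit) : ℝ :=
  ∑ α with answer α x = a, ∑ γ with answer γ z = c, G α γ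

lemma strategyMixture_add (G H : Bit × Bit → Bit × Bit → ℝ) (a c x z : Bit) :
    strategyMixture (fun α γ => G α γ + H α γ) a c x z =
      strategyMixture G a c x z + strategyMixture H a c x z := by
  simp only [strategyMixture, sum_add_distrib]

lemma strategyMixture_mul (P Q : Bit × Bit → ℝ) (a c x z : Bit) :
    strategyMixture (fun α γ => P α * Q γ) a c x z =
      (∑ α with answer α x = a, P α) * ∑ γ with answer γ z = c, Q γ :=
  (sum_mul_sum _ _ _ _).symm

section Hardy

variable {G : Bit × Bit → Bit × Bit → ℝ}

lemma strategyMixture_swap (a c x z : Bit) :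
    strategyMixture (fun γ α => G α γ) c a z x = strategyMixture G a c x z :=
  sum_comm

lemma le_strategyMixture (hG : ∀ α γ, 0 ≤ G α γ) (α γ : Bit × Bit) (x z : Bit) :
    G α γ ≤ strategyMixture G (answer α x) (answer γ z) x z :=
  (single_le_sum (f := G α) (fun γ _ => hG α γ) (by simp)).trans
    (single_le_sum (f := fun α => ∑ γ with answer γ z = _, G α γ)
      (fun α _ => sum_nonneg fun γ _ => hG α γ) (by simp))

lemma strategyMixture_le_add_sum (hG : ∀ α γ, 0 ≤ G α γ) (a a' c : Bit) :
    strategyMixture G a c 0 0 ≤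
      G (a, a') (c, 0) + G (a, a') (c, 1) + strategyMixture G (a' + 1) c 1 0 := by
  simp only [strategyMixture, sum_answer_zero_eq, sum_answer_one_eq]
  fin_cases a <;> fin_cases a' <;> simp <;> linarith [hG (0, 0) (c, 0), hG (0, 0) (c, 1),
    hG (1, 0) (c, 0), hG (1, 0) (c, 1), hG (0, 1) (c, 0), hG (0, 1) (c, 1), hG (1, 1) (c, 0),
    hG (1, 1) (c, 1)]

lemma strategyMixture_hardy (hG : ∀ α γ, 0 ≤ G α γ) (a a' c c' : Bit) :
    strategyMixture G a c 0 0 ≤ G (a, a') (c, c') + strategyMixture G (a' + 1) c 1 0 +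
      strategyMixture G a' (c' + 1) 1 1 := by
  have half := strategyMixture_le_add_sum hG a a' c
  have rest := le_strategyMixture hG (a, a') (c, c' + 1) 1 1
  simp only [answer, one_ne_zero, if_false] at rest
  have split : G (a, a') (c, 0) + G (a, a') (c, 1) =
      G (a, a') (c, c') + G (a, a') (c, c' + 1) := by
    fin_cases c'
    · rfl
    · exact add_comm _ _
  linarith

lemma strategyMixture_hardy_swap (hG : ∀ α γ, 0 ≤ G α γ) (a a' c c' : Bit) :
    strategyMixture G a c 0 0 ≤ G (a, a') (c, c') + strategyMixture G a (c' + 1) 0 1 +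
      strategyMixture G (a' + 1) c' 1 1 := by
  simpa only [strategyMixture_swap] using
    strategyMixture_hardy (G := fun γ α => G α γ) (fun γ α => hG α γ) c c' a a'

end Hardy

section Response

variable {O O' Λ Λ' : Type} [Fintype O] [Fintype O'] [MeasurableSpace Λ] [MeasurableSpace Λ']
  {r : O → Λ → ℝ} {r' : O' → Λ → ℝ}

lemma IsResponse.mul (h : IsResponse r) (h' : IsResponse r') :
    IsResponse fun (o : O × O') l => r o.1 l * r' o.2 l := by
  refine ⟨fun o => (h.1 _).mul (h'.1 _), fun o l => mul_nonneg (h.2.1 _ _) (h'.2.1 _ _),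
    fun l => ?_⟩
  simp only [Fintype.sum_prod_type, ← mul_sum, h'.2.2, mul_one, h.2.2]

lemma IsResponse.comp (h : IsResponse r) {f : Λ' → Λ} (hf : Measurable f) :
    IsResponse fun o l => r o (f l) :=
  ⟨fun o => (h.1 o).comp hf, fun o l => h.2.1 o (f l), fun l => h.2.2 (f l)⟩

lemma IsResponse.le_one (h : IsResponse r) (o : O) (l : Λ) : r o l ≤ 1 := by
  rw [← h.2.2 l]
  exact single_le_sum (fun o _ => h.2.1 o l) (mem_univ o)

lemma IsResponse.integrable (h : IsResponse r) (μ : Measure Λ) [IsFiniteMeasure μ] (o : O) :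
    Integrable (r o) μ :=
  .of_bound (h.1 o).aestronglyMeasurable 1 <| .of_forall fun l => by
    rw [Real.norm_of_nonneg (h.2.1 o l)]
    exact h.le_one o l

lemma IsResponse.sum_integral_eq_one (h : IsResponse r) (μ : Measure Λ) [IsProbabilityMeasure μ] :
    ∑ o, ∫ l, r o l ∂μ = 1 := by
  rw [← integral_finsetSum _ fun o _ => h.integrable μ o]
  simp [h.2.2]

end Response

section Bilocal

variable {Λ : Type} [MeasurableSpace Λ]

/-- The probability that a party with response `r o i l` (output `o`, input `i`) follows the
deterministic strategy `α` when its answers to the two inputs are drawn independently, given the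
hidden variable `l`. -/
def strategyProb (r : Bit → Bit → Λ → ℝ) (α : Bit × Bit) (l : Λ) : ℝ := r α.1 0 l * r α.2 1 l

lemma isResponse_strategyProb {r : Bit → Bit → Λ → ℝ} (h : ∀ i, IsResponse fun o => r o i) :
    IsResponse (strategyProb r) :=
  (h 0).mul (h 1)

lemma sum_strategyProb {r : Bit → Bit → Λ → ℝ} (h : ∀ i, IsResponse fun o => r o i)
    (o i : Bit) (l : Λ) : ∑ α with answer α i = o, strategyProb r α l = r o i l := by
  have total (i : Bit) : r 0 i l + r 1 i l = 1 := by simpa using (h i).2.2 l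
  obtain rfl | rfl : i = 0 ∨ i = 1 := by fin_cases i <;> simp
  · rw [sum_answer_zero_eq, strategyProb, strategyProb, ← mul_add, total, mul_one]
  · rw [sum_answer_one_eq, strategyProb, strategyProb, ← add_mul, total, one_mul]

/-- `G b α γ` is the probability that the sources distribute `α` and `γ` and Bob outputs `b`. -/
lemma exists_strategyMixture_of_mem_S0 {p : Corr} (hp : p ∈ S0) :
    ∃ (P Q : Bit × Bit → ℝ) (G : Bit → Bit × Bit → Bit × Bit → ℝ),
      (∀ α, 0 ≤ P α) ∧ (∀ γ, 0 ≤ Q γ) ∧ ∑ α, P α = 1 ∧ ∑ γ, Q γ = 1 ∧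
      (∀ b α γ, 0 ≤ G b α γ) ∧ (∀ α γ, G 0 α γ + G 1 α γ = P α * Q γ) ∧
      ∀ a b c x z, p a b c x z = strategyMixture (G b) a c x z := by
  obtain ⟨Λ₁, Λ₂, _, _, μ₁, μ₂, pA, pB, pC, _, _, hA, hB, hC, hp⟩ := hp
  have hα := isResponse_strategyProb hA
  have hγ := isResponse_strategyProb hC
  have hαbγ := ((hα.comp measurable_fst).mul hB).mul (hγ.comp measurable_snd)
  let F (b : Bit) (α γ : Bit × Bit) (l : Λ₁ × Λ₂) : ℝ :=
    strategyProb pA α l.1 * pB b l * strategyProb pC γ l.2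
  have hF (b : Bit) (α γ : Bit × Bit) : Integrable (F b α γ) (μ₁.prod μ₂) :=
    hαbγ.integrable _ ((α, b), γ)
  refine ⟨fun α => ∫ l, strategyProb pA α l ∂μ₁, fun γ => ∫ l, strategyProb pC γ l ∂μ₂,
    fun b α γ => ∫ l, F b α γ l ∂μ₁.prod μ₂, fun α => integral_nonneg (hα.2.1 α),
    fun γ => integral_nonneg (hγ.2.1 γ), hα.sum_integral_eq_one μ₁, hγ.sum_integral_eq_one μ₂,
    fun b α γ => integral_nonneg (hαbγ.2.1 ((α, b), γ)), fun α γ => ?_, fun a b c x z => ?_⟩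
  · rw [← integral_add (hF 0 α γ) (hF 1 α γ), ← integral_prod_mul]
    refine integral_congr_ae (.of_forall fun l => ?_)
    have total : pB 0 l + pB 1 l = 1 := by simpa using hB.2.2 l
    linear_combination strategyProb pA α l.1 * strategyProb pC γ l.2 * total
  · have hres := (((hA x).comp measurable_fst).mul hB).mul ((hC z).comp measurable_snd)
    rw [hp, ← integral_prod (fun l : Λ₁ × Λ₂ => pA a x l.1 * pB b l * pC c z l.2)
      (hres.integrable (μ₁.prod μ₂) ((a, b), c)), strategyMixture]
    simp only [← integral_finsetSum _ fun γ _ => hF b _ γ]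
    rw [← integral_finsetSum _ fun α _ => integrable_finsetSum _ fun γ _ => hF b α γ]
    simp only [F, ← mul_sum, ← sum_mul, sum_strategyProb hA, sum_strategyProb hC]

end Bilocal

/-- The weights of deterministic strategies whose answers to both inputs are uniform bits: such
weights have a single free parameter `u`, the weight of the strategy `(0, 0)`. -/
def unbiasedWeight (u : ℝ) (l : Bit × Bit) : ℝ := if l.1 = l.2 then u else 1 / 2 - u

lemma eq_unbiasedWeight {P : Bit × Bit → ℝ}
    (hP : ∀ a x, ∑ α with answer α x = a, P α = 1 / 2) : P = unbiasedWeight (P (0, 0)) := by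
  have h₀ := hP 0 0
  have h₁ := hP 0 1
  have h₁' := hP 1 1
  rw [sum_answer_zero_eq] at h₀
  rw [sum_answer_one_eq] at h₁ h₁'
  ext ⟨i, j⟩
  fin_cases i <;> fin_cases j <;> simp [unbiasedWeight] <;> linarith

lemma sum_answer_eq_half_of_product {P Q : Bit × Bit → ℝ} (hQ : ∑ γ, Q γ = 1)
    (h : ∀ a c x z, (∑ α with answer α x = a, P α) * (∑ γ with answer γ z = c, Q γ) = 1 / 4)
    (a x : Bit) : ∑ α with answer α x = a, P α = 1 / 2 := by
  have split := sum_fiberwise univ (fun γ => answer γ 0) Q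
  rw [hQ, Fin.sum_univ_two] at split
  linear_combination h a 0 x 0 + h a 1 x 0 - (∑ α with answer α x = a, P α) * split

/-- The outputs of Alice and Charlie are jointly uniform, for all inputs. -/
def HasUniformEnds (p : Corr) : Prop := ∀ a c x z, p a 0 c x z + p a 1 c x z = 1 / 4

lemma HasUniformEnds.ext {p q : Corr} (hp : HasUniformEnds p) (hq : HasUniformEnds q)
    (h : ∀ a c x z, p a 0 c x z = q a 0 c x z) : p = q := by
  ext a b c x z
  obtain rfl | rfl : b = 0 ∨ b = 1 := by fin_cases b <;> simp
  · exact h a c x z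
  · linarith [h a c x z, hp a c x z, hq a c x z]

lemma exists_unbiasedWeight_of_mem_S0 {p : Corr} (hp : p ∈ S0)
    (hu : HasUniformEnds p) :
    ∃ (u v : ℝ) (G : Bit × Bit → Bit × Bit → ℝ),
      u ∈ Set.Icc 0 (1 / 2) ∧ v ∈ Set.Icc 0 (1 / 2) ∧ (∀ α γ, 0 ≤ G α γ) ∧
      (∀ α γ, G α γ ≤ unbiasedWeight u α * unbiasedWeight v γ) ∧
      ∀ a c x z, p a 0 c x z = strategyMixture G a c x z := by
  obtain ⟨P, Q, G, hP, hQ, sP, sQ, hG, hPQ, hpG⟩ := exists_strategyMixture_of_mem_S0 hp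
  have uniform (a c x z : Bit) :
      (∑ α with answer α x = a, P α) * (∑ γ with answer γ z = c, Q γ) = 1 / 4 := by
    rw [← hu a c x z, hpG, hpG, ← strategyMixture_add, ← strategyMixture_mul]
    simp only [hPQ]
  have wP := eq_unbiasedWeight (sum_answer_eq_half_of_product sQ uniform)
  have wQ := eq_unbiasedWeight (sum_answer_eq_half_of_product sP fun c a z x => by
    rw [mul_comm, uniform])
  have range {R : Bit × Bit → ℝ} (hR : ∀ α, 0 ≤ R α) (wR : R = unbiasedWeight (R (0, 0))) :
      R (0, 0) ∈ Set.Icc 0 (1 / 2) := by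
    have h := hR (0, 1)
    rw [wR] at h
    exact ⟨hR _, by simpa [unbiasedWeight] using h⟩
  refine ⟨P (0, 0), Q (0, 0), G 0, range hP wP, range hQ wQ, hG 0, fun α γ => ?_,
    fun a c x z => hpG a 0 c x z⟩
  rw [← wP, ← wQ, ← hPQ]
  exact le_add_of_nonneg_right (hG 1 α γ)

section Tilted

variable {s c : ℝ}

/-- The correlation that entanglement swapping produces when Bob's vector is `s |01⟩ + c |10⟩` with
`s² + c² = 1` and Alice and Charlie measure `σ_x` and `σ_z`. -/
def tilted (s c : ℝ) : Corr := fun a b k x z =>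
  let r := (1 + (if x = 0 then 0 else (-1) ^ a.val * (s ^ 2 - c ^ 2)) +
    (if z = 0 then 0 else (-1) ^ k.val * (c ^ 2 - s ^ 2)) +
    (if x = z then (if x = 0 then 2 * s * c else -1) * (-1) ^ (a.val + k.val) else 0)) / 16
  if b = 0 then r else 1 / 4 - r

lemma hasUniformEnds_tilted (s c : ℝ) : HasUniformEnds (tilted s c) := fun a k x z => by
  simp [tilted]

lemma le_sixteenth_of_le_mul {u v k : ℝ} (hu : 0 ≤ u) (hv : 0 ≤ v)
    (h : k ≤ u * (1 / 2 - v)) (h' : k ≤ (1 / 2 - u) * v) : k ≤ 1 / 16 := by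
  rcases le_total u v with huv | hvu
  · nlinarith [sq_nonneg (u - 1 / 4), mul_nonneg hu (sub_nonneg.2 huv)]
  · nlinarith [sq_nonneg (v - 1 / 4), mul_nonneg hv (sub_nonneg.2 hvu)]

lemma tilted_notMem_S0 (hs : 0 < s) (hc : 0 < c) (h : s ^ 2 + c ^ 2 = 1) (hne : s ≠ c) :
    tilted s c ∉ S0 := by
  intro hmem
  obtain ⟨u, v, G, hu, hv, hG, hG_le, hp⟩ :=
    exists_unbiasedWeight_of_mem_S0 hmem (hasUniformEnds_tilted s c)
  have same_zero (i j k : Bit) : G (i, k) (j, k) = 0 := by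
    refine le_antisymm ((le_strategyMixture hG (i, k) (j, k) 1 1).trans_eq ?_) (hG _ _)
    rw [← hp]
    fin_cases k <;> simp [tilted, answer] <;> ring
  have p0000 : G (0, 0) (0, 1) + G (0, 1) (0, 0) = (1 + 2 * s * c) / 16 := by
    simpa [tilted, strategyMixture, sum_answer_zero_eq, same_zero] using (hp 0 0 0 0).symm
  have p0001 : G (0, 1) (0, 0) + G (0, 1) (1, 0) = (1 + (c ^ 2 - s ^ 2)) / 16 := by
    simpa [tilted, strategyMixture, sum_answer_zero_eq, sum_answer_one_eq, same_zero]
      using (hp 0 0 0 1).symm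
  have p1110 : G (0, 1) (1, 0) + G (1, 1) (1, 0) = (1 + (c ^ 2 - s ^ 2)) / 16 := by
    simpa [tilted, strategyMixture, sum_answer_zero_eq, sum_answer_one_eq, same_zero]
      using (hp 1 1 1 0).symm
  have p0010 : G (0, 0) (0, 1) + G (1, 0) (0, 1) = (1 + (s ^ 2 - c ^ 2)) / 16 := by
    simpa [tilted, strategyMixture, sum_answer_zero_eq, sum_answer_one_eq, same_zero]
      using (hp 0 0 1 0).symm
  have p1101 : G (1, 0) (0, 1) + G (1, 0) (1, 1) = (1 + (s ^ 2 - c ^ 2)) / 16 := by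
    simpa [tilted, strategyMixture, sum_answer_zero_eq, sum_answer_one_eq, same_zero]
      using (hp 1 1 0 1).symm
  have m_eq : G (0, 1) (0, 0) = G (1, 1) (1, 0) := by linarith
  have n_eq : G (0, 0) (0, 1) = G (1, 0) (1, 1) := by linarith
  have m_le : G (0, 1) (0, 0) ≤ 1 / 16 := by
    refine le_sixteenth_of_le_mul hu.1 hv.1 (m_eq.trans_le ?_) ?_
    · simpa [unbiasedWeight] using hG_le (1, 1) (1, 0)
    · simpa [unbiasedWeight] using hG_le (0, 1) (0, 0)
  have n_le : G (0, 0) (0, 1) ≤ 1 / 16 := by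
    refine le_sixteenth_of_le_mul hu.1 hv.1 ?_ (n_eq.trans_le ?_)
    · simpa [unbiasedWeight] using hG_le (0, 0) (0, 1)
    · simpa [unbiasedWeight] using hG_le (1, 0) (1, 1)
  have h_le : s ≤ c := le_of_mul_le_mul_right
    (by linarith [hG (0, 1) (1, 0)] : s * c ≤ c * c) hc
  have h_ge : c ≤ s := le_of_mul_le_mul_right
    (by linarith [hG (1, 0) (0, 1)] : c * s ≤ s * s) hs
  exact hne (h_le.antisymm h_ge)

end Tilted

section Mixed

variable {V μ : ℝ}

/-- The mixture of a post-selected noisy PR box with visibility `V` and the local Bell test. -/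
def mixed (V μ : ℝ) : Corr := μ • pPS V (1 / 4) + (1 - μ) • pL

lemma mixed_apply_zero (V μ : ℝ) (a c x z : Bit) : mixed V μ a 0 c x z =
    μ * (1 + V * (-1) ^ (a.val + c.val + x.val * z.val)) / 16 +
      (1 - μ) * (if x = c then (if a = 0 then 1 / 4 else 0) else 1 / 8) := by
  simp only [mixed, pPS, pL, prBox, Pi.add_apply, Pi.smul_apply, smul_eq_mul, if_true]
  split_ifs <;> ring

lemma hasUniformEnds_pPS (V q : ℝ) : HasUniformEnds (pPS V q) := fun a c x z => by
  simp [pPS]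

lemma hasUniformEnds_pL : HasUniformEnds pL := fun a c x z => by
  fin_cases a <;> by_cases h : x = c <;> norm_num [pL, h]

lemma hasUniformEnds_mixed (V μ : ℝ) : HasUniformEnds (mixed V μ) := fun a c x z => by
  simp only [mixed, Pi.add_apply, Pi.smul_apply, smul_eq_mul]
  linear_combination μ * hasUniformEnds_pPS V (1 / 4) a c x z +
    (1 - μ) * hasUniformEnds_pL a c x z

lemma exists_bounds_of_mixed_mem_S0 (h : mixed V μ ∈ S0) :
    ∃ u v : ℝ, u ∈ Set.Icc 0 (1 / 2) ∧ 1 - μ * (1 - V) ≤ 4 * u ∧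
      2 - 3 * (μ * (1 - V)) ≤ 16 * ((1 / 2 - u) * v) ∧
      2 * μ - 3 * (μ * (1 - V)) ≤ 16 * (u * (1 / 2 - v)) := by
  obtain ⟨u, v, G, hu, -, hG, hG_le, hp⟩ :=
    exists_unbiasedWeight_of_mem_S0 h (hasUniformEnds_mixed V μ)
  let p (a c x z : Bit) : ℝ := mixed V μ a 0 c x z
  have hpG : p = strategyMixture G := by
    ext a c x z
    exact hp a c x z
  have G_00_00 : G (0, 0) (0, 0) ≤ u * v := by
    simpa [unbiasedWeight] using hG_le (0, 0) (0, 0)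
  have G_00_01 : G (0, 0) (0, 1) ≤ u * (1 / 2 - v) := by
    simpa [unbiasedWeight] using hG_le (0, 0) (0, 1)
  have G_10_11 : G (1, 0) (1, 1) ≤ (1 / 2 - u) * v := by
    simpa [unbiasedWeight] using hG_le (1, 0) (1, 1)
  have half : p 0 0 0 0 ≤ G (0, 0) (0, 0) + G (0, 0) (0, 1) + p 1 0 1 0 := by
    rw [hpG]
    exact strategyMixture_le_add_sum hG 0 0 0
  have hardy : p 0 0 0 0 ≤ G (0, 0) (0, 1) + p 1 0 1 0 + p 0 0 1 1 := by
    rw [hpG]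
    exact strategyMixture_hardy hG 0 0 0 1
  have hardy_swap : p 1 1 0 0 ≤ G (1, 0) (1, 1) + p 1 0 0 1 + p 1 1 1 1 := by
    rw [hpG]
    exact strategyMixture_hardy_swap hG 1 0 1 1
  norm_num [p, mixed_apply_zero] at half hardy hardy_swap
  exact ⟨u, v, hu, by linarith, by linarith, by linarith⟩

/-- The three bounds force the quadratic `y² - (1 + μ) y + 2 μ - 3 μ (1 - V)` to be nonpositive at
`y = 4 u ≥ 1 - μ (1 - V)`. It is positive at `1 - μ (1 - V)` by `hV`, and stays positive to the
right because this point lies beyond the vertex or the discriminant is negative. -/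
lemma mixed_notMem_S0 (hμ : 0 < μ) (hV : 3 - 4 * V < μ * ((1 - V) * (2 - V)))
    (hμV : μ * (3 - 2 * V) ≤ 1 ∨ 1 + 6 * μ + μ ^ 2 < 12 * (μ * V)) : mixed V μ ∉ S0 := by
  intro h
  obtain ⟨u, v, hu, hu_ge, hv, hv'⟩ := exists_bounds_of_mixed_mem_S0 h
  have quadratic_nonpos :
      (4 * u) ^ 2 - (1 + μ) * (4 * u) + (2 * μ - 3 * (μ * (1 - V))) ≤ 0 := by
    linarith [mul_le_mul_of_nonneg_left hv hu.1,
      mul_le_mul_of_nonneg_left hv' (sub_nonneg.2 hu.2)]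
  rcases hμV with vertex | discrim
  · have at_left : 0 < μ * (μ * ((1 - V) * (2 - V)) - (3 - 4 * V)) :=
      mul_pos hμ (sub_pos.2 hV)
    have slope : 0 ≤ (4 * u - (1 - μ * (1 - V))) * (4 * u - μ * (2 - V)) :=
      mul_nonneg (by linarith) (by linarith)
    linarith
  · linarith [sq_nonneg (4 * u - (1 + μ) / 2)]

end Mixed

section Exchange

/-- The correlation with the roles of Alice and Charlie interchanged. -/
def exchange (p : Corr) : Corr := fun a b c x z => p c b a z x

lemma HasUniformEnds.exchange {p : Corr} (h : HasUniformEnds p) :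
    HasUniformEnds (exchange p) := fun a c x z => h c a z x

lemma mem_S1_ABL_BCO_of_exchange {p : Corr} (h : exchange p ∈ S1_ABO_BCL) : p ∈ S1_ABL_BCO := by
  obtain ⟨Λ, _, μ, N, pC, hμ, hN, ⟨nonneg, total, nsig₁, nsig₂⟩, hC, hp⟩ := h
  refine ⟨Λ, _, μ, pC, fun b c l z => N c b z l, hμ, hC, fun b c z => hN c b z,
    ⟨fun b c l z => nonneg c b z l, fun l z => ?_, fun b l z z' => nsig₂ b z z' l,
      fun c l l' z => nsig₁ c z l l'⟩, fun a b c x z => ?_⟩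
  · rw [sum_comm]
    exact total z l
  · simp only [mul_comm (pC _ _ _)]
    exact hp c b a z x

end Exchange

section Steered

variable {g : Bit × Bit → ℝ} {d : Bit → Bit × Bit → ℝ}

/-- A box with uniform marginals for Alice and Bob, whose input for Bob is a strategy `l` of
Charlie: Bob outputs `0` with probability `g l`, and Alice's bias towards the output `0`, weighted
by that probability, is then `d x l`. -/
def steeredBox (g : Bit × Bit → ℝ) (d : Bit → Bit × Bit → ℝ) (a b x : Bit) (l : Bit × Bit) : ℝ :=
  let r := (g l + (-1) ^ a.val * d x l) / 2
  if b = 0 then r else 1 / 2 - r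

/-- The correlation in which a classical source sends a uniformly random deterministic strategy to
Charlie and to Bob, who feeds it into the box `steeredBox g d` that he shares with Alice. -/
def steered (g : Bit × Bit → ℝ) (d : Bit → Bit × Bit → ℝ) : Corr := fun a b c x z =>
  (∑ l with answer l z = c, steeredBox g d a b x l) / 4

/-- The correlations `steered g d` whose box has nonnegative entries. -/
def steeredCorrs : Set Corr :=
  {p | ∃ g d, (∀ x l, |d x l| ≤ g l ∧ |d x l| ≤ 1 - g l) ∧ p = steered g d}

lemma isNoSignallingBox_steeredBox (h : ∀ x l, |d x l| ≤ g l ∧ |d x l| ≤ 1 - g l) :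
    IsNoSignallingBox (steeredBox g d) := by
  refine ⟨fun a b x l => ?_, fun x l => ?_, fun a x l l' => ?_, fun b x x' l => ?_⟩
  · obtain ⟨h_le, h_le'⟩ := h x l
    rw [abs_le] at h_le h_le'
    fin_cases a <;> fin_cases b <;> simp [steeredBox] <;> linarith
  · norm_num [steeredBox]
  · simp [steeredBox]
  · fin_cases b <;> simp [steeredBox] <;> ring

lemma steered_mem_S1_ABO_BCL (h : ∀ x l, |d x l| ≤ g l ∧ |d x l| ≤ 1 - g l) :
    steered g d ∈ S1_ABO_BCL := by
  refine ⟨Bit × Bit, inferInstance, (PMF.uniformOfFintype (Bit × Bit)).toMeasure, steeredBox g d,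
    fun c z l => if answer l z = c then 1 else 0, inferInstance,
    fun _ _ _ => measurable_of_countable _, isNoSignallingBox_steeredBox h,
    fun z => ⟨fun _ => measurable_of_countable _, fun c l => ?_, fun l => ?_⟩,
    fun a b c x z => ?_⟩
  · dsimp only
    split_ifs <;> norm_num
  · simp
  · simp [PMF.integral_eq_sum, steered, sum_filter, mul_sum, div_eq_inv_mul]

lemma steeredCorrs_subset_S1_ABO_BCL : steeredCorrs ⊆ S1_ABO_BCL := by
  rintro _ ⟨g, d, h, rfl⟩
  exact steered_mem_S1_ABO_BCL h

lemma convex_steeredCorrs : Convex ℝ steeredCorrs := by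
  rintro _ ⟨g, d, h, rfl⟩ _ ⟨g', d', h', rfl⟩ t t' ht ht' htt'
  refine ⟨t • g + t' • g', t • d + t' • d', fun x l => ?_, ?_⟩
  · have triangle : |t * d x l + t' * d' x l| ≤ t * |d x l| + t' * |d' x l| := by
      simpa only [abs_mul, abs_of_nonneg ht, abs_of_nonneg ht'] using
        abs_add_le (t * d x l) (t' * d' x l)
    have le := mul_le_mul_of_nonneg_left (h x l).1 ht
    have le' := mul_le_mul_of_nonneg_left (h' x l).1 ht'
    have le_one_sub := mul_le_mul_of_nonneg_left (h x l).2 ht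
    have le_one_sub' := mul_le_mul_of_nonneg_left (h' x l).2 ht'
    simp only [Pi.add_apply, Pi.smul_apply, smul_eq_mul]
    constructor <;> linarith
  · ext a b c x z
    simp only [steered, steeredBox, Pi.add_apply, Pi.smul_apply, smul_eq_mul, sum_div, mul_sum,
      ← sum_add_distrib]
    refine sum_congr rfl fun l _ => ?_
    split_ifs
    · ring
    · linear_combination 1 / 8 * htt'

lemma hasUniformEnds_steered (g : Bit × Bit → ℝ) (d : Bit → Bit × Bit → ℝ) :
    HasUniformEnds (steered g d) := fun a c x z => by
  have card : #{l : Bit × Bit | answer l z = c} = 2 := by decide +revert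
  simp only [steered, ← add_div, ← sum_add_distrib]
  norm_num [steeredBox, card]

lemma mem_steeredCorrs {p : Corr} (hp : HasUniformEnds p) (g : Bit × Bit → ℝ)
    (d : Bit → Bit × Bit → ℝ) (h : ∀ x l, |d x l| ≤ g l ∧ |d x l| ≤ 1 - g l)
    (hp_zero : ∀ a c x z, p a 0 c x z = steered g d a 0 c x z) : p ∈ steeredCorrs :=
  ⟨g, d, h, hp.ext (hasUniformEnds_steered g d) hp_zero⟩

end Steered

lemma exchange_tilted (s c : ℝ) : exchange (tilted s c) = tilted c s := by
  refine (hasUniformEnds_tilted s c).exchange.ext (hasUniformEnds_tilted c s) fun a k x z => ?_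
  fin_cases x <;> fin_cases z <;> simp [exchange, tilted] <;> ring

lemma tilted_mem_steeredCorrs {s c : ℝ} (hs : 0 ≤ s) (hc : 0 ≤ c) (h : s ^ 2 + c ^ 2 = 1) :
    tilted s c ∈ steeredCorrs := by
  have hsc : |2 * s * c| ≤ 1 := by
    rw [abs_of_nonneg (by positivity)]
    linarith [sq_nonneg (s - c)]
  let g (l : Bit × Bit) : ℝ := if l.2 = 0 then c ^ 2 / 2 else s ^ 2 / 2
  have hg (l : Bit × Bit) : 0 ≤ g l ∧ g l ≤ 1 - g l := by
    constructor <;> dsimp only [g] <;> split_ifs <;> linarith [sq_nonneg s, sq_nonneg c]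
  let e (x : Bit) (l : Bit × Bit) : ℝ :=
    if x = 0 then (-1) ^ l.1.val * (2 * s * c) else -(-1) ^ l.2.val
  have he (x : Bit) (l : Bit × Bit) : |e x l| ≤ 1 := by
    dsimp only [e]
    split_ifs
    · simpa [abs_mul] using hsc
    · simp
  refine mem_steeredCorrs (hasUniformEnds_tilted s c) g (fun x l => g l * e x l) (fun x l => ?_)
    fun a k x z => ?_
  · have h_le : |g l * e x l| ≤ g l := by
      rw [abs_mul, abs_of_nonneg (hg l).1]
      exact mul_le_of_le_one_right (hg l).1 (he x l)
    exact ⟨h_le, h_le.trans (hg l).2⟩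
  · have hc2 : c ^ 2 = 1 - s ^ 2 := by linarith
    fin_cases k <;> fin_cases x <;> fin_cases z <;>
      simp [tilted, steered, steeredBox, sum_answer_zero_eq, sum_answer_one_eq, g, e, hc2] <;> ring

lemma tilted_mem_S1cap {s c : ℝ} (hs : 0 ≤ s) (hc : 0 ≤ c) (h : s ^ 2 + c ^ 2 = 1) :
    tilted s c ∈ S1cap :=
  ⟨steeredCorrs_subset_S1_ABO_BCL (tilted_mem_steeredCorrs hs hc h),
    mem_S1_ABL_BCO_of_exchange <| steeredCorrs_subset_S1_ABO_BCL <| by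
      rw [exchange_tilted]
      exact tilted_mem_steeredCorrs hc hs (by linarith)⟩

section MixedModels

lemma pL_mem_steeredCorrs : pL ∈ steeredCorrs := by
  refine mem_steeredCorrs hasUniformEnds_pL (fun _ => 1 / 2)
    (fun x l => ![!![1 / 2, 1 / 2; 1 / 2, -1 / 2], !![-1 / 2, 1 / 2; 1 / 2, 1 / 2]] x l.1 l.2)
    (fun x ⟨i, j⟩ => ?_) fun a c x z => ?_
  · fin_cases x <;> fin_cases i <;> fin_cases j <;> norm_num [abs_div]
  · fin_cases a <;> fin_cases c <;> fin_cases x <;> fin_cases z <;>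
      norm_num [pL, steered, steeredBox, sum_answer_zero_eq, sum_answer_one_eq]

lemma exchange_pL_mem_steeredCorrs : exchange pL ∈ steeredCorrs := by
  refine mem_steeredCorrs hasUniformEnds_pL.exchange
    (fun l => !![1, 1 / 2; 1 / 2, 0] l.1 l.2) (fun _ l => !![0, 1 / 2; -1 / 2, 0] l.1 l.2)
    (fun _ ⟨i, j⟩ => ?_) fun a c x z => ?_
  · fin_cases i <;> fin_cases j <;> norm_num [abs_div]
  · fin_cases a <;> fin_cases c <;> fin_cases x <;> fin_cases z <;>
      norm_num [exchange, pL, steered, steeredBox, sum_answer_zero_eq, sum_answer_one_eq]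

lemma pPS_one_half_mem_steeredCorrs : pPS (1 / 2) (1 / 4) ∈ steeredCorrs := by
  refine mem_steeredCorrs (hasUniformEnds_pPS _ _) (fun _ => 1 / 4)
    (fun x l => ![!![1 / 4, 0; 0, -1 / 4], !![0, 1 / 4; -1 / 4, 0]] x l.1 l.2)
    (fun x ⟨i, j⟩ => ?_) fun a c x z => ?_
  · fin_cases x <;> fin_cases i <;> fin_cases j <;> norm_num [abs_div]
  · fin_cases a <;> fin_cases c <;> fin_cases x <;> fin_cases z <;>
      norm_num [pPS, prBox, steered, steeredBox, sum_answer_zero_eq, sum_answer_one_eq]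

lemma exchange_pPS (V q : ℝ) : exchange (pPS V q) = pPS V q := by
  ext a b c x z
  simp only [exchange, pPS, prBox, add_comm c.val, mul_comm z.val]

lemma mixed_one_one_half_mem_steeredCorrs : mixed 1 (1 / 2) ∈ steeredCorrs := by
  refine mem_steeredCorrs (hasUniformEnds_mixed _ _)
    (fun l => !![1 / 2, 1 / 4; 1 / 4, 1 / 2] l.1 l.2)
    (fun x l => ![!![1 / 2, 1 / 4; 1 / 4, -1 / 2], !![0, 1 / 4; -1 / 4, 1 / 2]] x l.1 l.2)
    (fun x ⟨i, j⟩ => ?_) fun a c x z => ?_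
  · fin_cases x <;> fin_cases i <;> fin_cases j <;> norm_num [abs_div]
  · fin_cases a <;> fin_cases c <;> fin_cases x <;> fin_cases z <;>
      norm_num [mixed_apply_zero, steered, steeredBox, sum_answer_zero_eq, sum_answer_one_eq]

lemma exchange_mixed_one_one_half_mem_steeredCorrs : exchange (mixed 1 (1 / 2)) ∈ steeredCorrs := by
  refine mem_steeredCorrs (hasUniformEnds_mixed _ _).exchange
    (fun l => !![1 / 2, 1 / 2; 1 / 2, 0] l.1 l.2)
    (fun x l => ![!![1 / 2, 0; -1 / 2, 0], !![0, 1 / 2; -1 / 2, 0]] x l.1 l.2)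
    (fun x ⟨i, j⟩ => ?_) fun a c x z => ?_
  · fin_cases x <;> fin_cases i <;> fin_cases j <;> norm_num [abs_div]
  · fin_cases a <;> fin_cases c <;> fin_cases x <;> fin_cases z <;>
      norm_num [exchange, mixed_apply_zero, steered, steeredBox, sum_answer_zero_eq,
        sum_answer_one_eq]

/-- The constraints `1/2 ≤ V ≤ 1`, `0 ≤ μ`, `μ V ≤ 1/2` cut out a triangle in the coordinates
`(μ, μ V)`, in which `mixed` is affine; its vertices are these three correlations. -/
lemma mixed_eq_add_smul (V μ : ℝ) :
    mixed V μ = (1 - 2 * (μ * V)) • pL + (4 * (μ * V) - 2 * μ) • mixed 1 (1 / 2) +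
      (2 * μ - 2 * (μ * V)) • pPS (1 / 2) (1 / 4) := by
  ext a b c x z
  simp only [mixed, pPS, prBox, Pi.add_apply, Pi.smul_apply, smul_eq_mul]
  split_ifs <;> ring

variable {V μ : ℝ}

lemma mixed_mem_of_convex {K : Set Corr} (hK : Convex ℝ K) (hL : pL ∈ K)
    (hmixed : mixed 1 (1 / 2) ∈ K) (hPS : pPS (1 / 2) (1 / 4) ∈ K) (hV : 1 / 2 ≤ V)
    (hV1 : V ≤ 1) (hμ : 0 ≤ μ) (h : μ * V ≤ 1 / 2) : mixed V μ ∈ K := by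
  have le := mul_le_mul_of_nonneg_left hV hμ
  have le_one := mul_le_mul_of_nonneg_left hV1 hμ
  have mem : ∑ i, ![1 - 2 * (μ * V), 4 * (μ * V) - 2 * μ, 2 * μ - 2 * (μ * V)] i •
      ![pL, mixed 1 (1 / 2), pPS (1 / 2) (1 / 4)] i ∈ K := by
    refine hK.sum_mem ?_ ?_ ?_
    · simp only [mem_univ, forall_const, Fin.forall_fin_succ]
      exact ⟨by simp; linarith, by simp; linarith, by simp; linarith, fun i => i.elim0⟩
    · simp [Fin.sum_univ_three]
      ring
    · simp only [mem_univ, forall_const, Fin.forall_fin_succ]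
      exact ⟨hL, hmixed, hPS, fun i => i.elim0⟩
  rw [Fin.sum_univ_three] at mem
  rwa [mixed_eq_add_smul]

lemma mixed_mem_S1cap (hV : 1 / 2 ≤ V) (hV1 : V ≤ 1) (hμ : 0 ≤ μ) (h : μ * V ≤ 1 / 2) :
    mixed V μ ∈ S1cap := by
  have exchange_convex : Convex ℝ (exchange ⁻¹' steeredCorrs) :=
    convex_steeredCorrs.is_linear_preimage ⟨fun _ _ => rfl, fun _ _ => rfl⟩
  have exchange_pPS_mem : pPS (1 / 2) (1 / 4) ∈ exchange ⁻¹' steeredCorrs := by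
    rw [Set.mem_preimage, exchange_pPS]
    exact pPS_one_half_mem_steeredCorrs
  have mem : mixed V μ ∈ steeredCorrs := mixed_mem_of_convex convex_steeredCorrs
    pL_mem_steeredCorrs mixed_one_one_half_mem_steeredCorrs pPS_one_half_mem_steeredCorrs
    hV hV1 hμ h
  have exchange_mem : mixed V μ ∈ exchange ⁻¹' steeredCorrs := mixed_mem_of_convex exchange_convex
    exchange_pL_mem_steeredCorrs exchange_mixed_one_one_half_mem_steeredCorrs exchange_pPS_mem
    hV hV1 hμ h
  exact ⟨steeredCorrs_subset_S1_ABO_BCL mem,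
    mem_S1_ABL_BCO_of_exchange (steeredCorrs_subset_S1_ABO_BCL exchange_mem)⟩

end MixedModels

open Matrix

section Measurements

open scoped MatrixOrder

variable {m n : Type} [Fintype m] [Fintype n]

lemma isPOVM_of_isStarProjection [DecidableEq n] {M : Bit → Matrix n n ℂ}
    (h : ∀ o, IsStarProjection (M o)) (hM : ∑ o, M o = 1) : IsPOVM M :=
  ⟨fun o => nonneg_iff_posSemidef.1 (h o).nonneg, hM⟩

lemma isState_ketbra {v : n → ℂ} (h : v ⬝ᵥ star v = 1) : IsState (ketbra v) :=
  ⟨posSemidef_vecMulVec_self_star v, by rw [ketbra, trace_vecMulVec, h]⟩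

lemma IsState.convexComb {σ τ : Matrix n n ℂ} (hσ : IsState σ)
    (hτ : IsState τ) {s t : ℝ} (hs : 0 ≤ s) (ht : 0 ≤ t) (hst : s + t = 1) :
    IsState (s • σ + t • τ) := by
  refine ⟨(hσ.1.smul hs).add (hτ.1.smul ht), ?_⟩
  rw [trace_add, trace_smul, trace_smul, hσ.2, hτ.2, ← add_smul, hst, one_smul]

lemma isStarProjection_ketbra {v : n → ℂ} (h : v ⬝ᵥ star v = 1) :
    IsStarProjection (ketbra v) := by
  refine ⟨?_, (posSemidef_vecMulVec_self_star v).isHermitian⟩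
  rw [IsIdempotentElem, ketbra, vecMulVec_mul_vecMulVec, dotProduct_comm, h, one_smul]

lemma isPOVM_vecMeas [DecidableEq n] {v : n → ℂ} (h : v ⬝ᵥ star v = 1) : IsPOVM (vecMeas v) := by
  refine isPOVM_of_isStarProjection (fun o => ?_) (by simp [vecMeas])
  rw [vecMeas]
  split_ifs
  · exact isStarProjection_ketbra h
  · exact (isStarProjection_ketbra h).one_sub

lemma isPOVM_obsProj {O : Matrix Bit Bit ℂ} (h : O.IsHermitian) (h' : O * O = 1) :
    IsPOVM (obsProj O) := by
  refine isPOVM_of_isStarProjection (fun o => ⟨?_, ?_⟩) ?_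
  · fin_cases o <;> simp [IsIdempotentElem, obsProj, mul_add, add_mul, h', smul_smul] <;> module
  · fin_cases o <;> simp [obsProj, isSelfAdjoint_iff, star_eq_conjTranspose, h.eq]
  · simp [obsProj]
    module

lemma isPOVM_ite_eq [DecidableEq n] (k : Bit) :
    IsPOVM fun o => if o = k then (1 : Matrix n n ℂ) else 0 := by
  refine isPOVM_of_isStarProjection (fun o => ?_) (by simp)
  split_ifs
  exacts [.one _, .zero _]

lemma isPOVM_kronecker_one [DecidableEq m] [DecidableEq n] {M : Bit → Matrix m m ℂ}
    (hM : IsPOVM M) : IsPOVM fun o => M o ⊗ₖ (1 : Matrix n n ℂ) :=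
  ⟨fun o => (hM.1 o).kronecker .one, by
    rw [Fin.sum_univ_two, ← add_kronecker, ← Fin.sum_univ_two, hM.2, one_kronecker_one]⟩

lemma isPOVM_submatrix [DecidableEq m] [DecidableEq n] {M : Bit → Matrix m m ℂ}
    (hM : IsPOVM M) (e : n ≃ m) : IsPOVM fun o => (M o).submatrix e e := by
  refine ⟨fun o => (hM.1 o).submatrix e, ?_⟩
  rw [← submatrix_one_equiv e, ← hM.2]
  simp only [Fin.sum_univ_two, submatrix_add, Pi.add_apply]

end Measurements

section ZeroExtend

variable {m n : Type} [Fintype n] [DecidableEq m]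

/-- The matrix `M`, regarded as a matrix on a larger index type through an embedding `f`, with
zero entries outside the range of `f`. -/
def zeroExtend (f : n → m) (M : Matrix n n ℂ) : Matrix m m ℂ :=
  (1 : Matrix m m ℂ).submatrix id f * M * ((1 : Matrix m m ℂ).submatrix id f)ᴴ

lemma posSemidef_zeroExtend [Finite m] (f : n → m) {M : Matrix n n ℂ} (hM : M.PosSemidef) :
    (zeroExtend f M).PosSemidef :=
  hM.mul_mul_conjTranspose_same _

variable [Fintype m]

lemma trace_zeroExtend_mul (f : n → m) (M : Matrix n n ℂ) (N : Matrix m m ℂ) :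
    (zeroExtend f M * N).trace = (M * N.submatrix f f).trace := by
  rw [zeroExtend, Matrix.mul_assoc, trace_mul_comm, ← Matrix.mul_assoc, trace_mul_comm]
  congr 2
  ext i j
  simp [mul_apply, one_apply]

lemma trace_zeroExtend {f : n → m} (hf : f.Injective) (M : Matrix n n ℂ) :
    (zeroExtend f M).trace = M.trace := by
  classical
  simpa [submatrix_one _ hf] using trace_zeroExtend_mul f M 1

lemma IsState.zeroExtend {σ : Matrix n n ℂ} (hσ : IsState σ) {f : n → m} (hf : f.Injective) :
    IsState (zeroExtend f σ) :=
  ⟨posSemidef_zeroExtend f hσ.1, (trace_zeroExtend hf σ).trans hσ.2⟩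

lemma fromBlocks_eq_zeroExtend_add [DecidableEq n] (M : Matrix m m ℂ) (N : Matrix n n ℂ) :
    fromBlocks M 0 0 N = zeroExtend Sum.inl M + zeroExtend Sum.inr N := by
  ext (i | i) (j | j) <;> simp [zeroExtend, mul_apply, one_apply]

lemma isPOVM_fromBlocks [DecidableEq n] {M : Bit → Matrix m m ℂ} {N : Bit → Matrix n n ℂ}
    (hM : IsPOVM M) (hN : IsPOVM N) : IsPOVM fun o => fromBlocks (M o) 0 0 (N o) := by
  refine ⟨fun o => ?_, ?_⟩
  · dsimp only
    rw [fromBlocks_eq_zeroExtend_add]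
    exact (posSemidef_zeroExtend _ (hM.1 o)).add (posSemidef_zeroExtend _ (hN.1 o))
  · have hM' := hM.2
    have hN' := hN.2
    rw [Fin.sum_univ_two] at hM' hN' ⊢
    rw [fromBlocks_add, hM', hN', add_zero, add_zero, fromBlocks_one]

end ZeroExtend

section SourceMixture

variable {hA hB hB' hC kB kC : Type} [Fintype hA] [Fintype hB] [Fintype hB'] [Fintype hC]

lemma bornCorr_eq_sum (ρ : Matrix (hA × hB) (hA × hB) ℂ)
    (σ : Matrix (hB' × hC) (hB' × hC) ℂ) (A : Bit → Bit → Matrix hA hA ℂ)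
    (B : Bit → Matrix (hB × hB') (hB × hB') ℂ) (C : Bit → Bit → Matrix hC hC ℂ)
    (a b c x z : Bit) : bornCorr ρ σ A B C a b c x z = (∑ i, ∑ j, ∑ k, ∑ l,
      ρ i j * σ k l * (A a x j.1 i.1 * B b (j.2, l.1) (i.2, k.1) * C c z l.2 k.2)).re := by
  simp only [bornCorr, trace, diag_apply, mul_apply, kroneckerMap_apply, submatrix_apply]
  rw [Fintype.sum_prod_type]
  simp only [Fintype.sum_prod_type (α₁ := hA × hB)]
  exact congrArg _ (sum_congr rfl fun i _ => sum_comm)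

/-- The operator on Bob's share of the second source that results from measuring the first source
`ρ` with the effect `M` of Alice and the effect `N` of Bob. -/
def bobEffect (ρ : Matrix (hA × hB) (hA × hB) ℂ) (M : Matrix hA hA ℂ)
    (N : Matrix (hB × hB') (hB × hB') ℂ) : Matrix hB' hB' ℂ :=
  of fun l k => ∑ i, ∑ j, ρ i j * (M j.1 i.1 * N (j.2, l) (i.2, k))

lemma bornCorr_eq_trace_mul_bobEffect (ρ : Matrix (hA × hB) (hA × hB) ℂ)
    (σ : Matrix (hB' × hC) (hB' × hC) ℂ) (A : Bit → Bit → Matrix hA hA ℂ)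
    (B : Bit → Matrix (hB × hB') (hB × hB') ℂ) (C : Bit → Bit → Matrix hC hC ℂ)
    (a b c x z : Bit) : bornCorr ρ σ A B C a b c x z =
      (σ * (bobEffect ρ (A a x) (B b) ⊗ₖ C c z)).trace.re := by
  rw [bornCorr_eq_sum]
  simp only [trace, diag_apply, mul_apply, kroneckerMap_apply, bobEffect, of_apply, sum_mul,
    mul_sum]
  simp only [sum_comm (s := (univ : Finset (hB' × hC))) (t := (univ : Finset (hA × hB)))]
  refine congrArg _ (sum_congr rfl fun i _ => sum_congr rfl fun j _ => sum_congr rfl fun k _ =>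
    sum_congr rfl fun l _ => by ring)

lemma bornCorr_zeroExtend [DecidableEq hB'] [DecidableEq hC] [Fintype kB] [Fintype kC]
    (ρ : Matrix (hA × hB) (hA × hB) ℂ) (f : kB → hB') (g : kC → hC)
    (σ : Matrix (kB × kC) (kB × kC) ℂ) (A : Bit → Bit → Matrix hA hA ℂ)
    (B : Bit → Matrix (hB × hB') (hB × hB') ℂ) (C : Bit → Bit → Matrix hC hC ℂ) :
    bornCorr ρ (zeroExtend (Prod.map f g) σ) A B C =
      bornCorr ρ σ A (fun b => (B b).submatrix (Prod.map id f) (Prod.map id f))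
        (fun c z => (C c z).submatrix g g) := by
  funext a b c x z
  rw [bornCorr_eq_trace_mul_bobEffect, bornCorr_eq_trace_mul_bobEffect, trace_zeroExtend_mul]
  rfl

lemma bornCorr_convexComb (ρ : Matrix (hA × hB) (hA × hB) ℂ)
    (s t : ℝ) (σ τ : Matrix (hB' × hC) (hB' × hC) ℂ) (A : Bit → Bit → Matrix hA hA ℂ)
    (B : Bit → Matrix (hB × hB') (hB × hB') ℂ) (C : Bit → Bit → Matrix hC hC ℂ) :
    bornCorr ρ (s • σ + t • τ) A B C = s • bornCorr ρ σ A B C + t • bornCorr ρ τ A B C := by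
  funext a b c x z
  simp only [Pi.add_apply, Pi.smul_apply, bornCorr_eq_trace_mul_bobEffect, add_mul, smul_mul,
    trace_add, trace_smul, Complex.add_re, Complex.smul_re]

/-- The correlations realizable with the source `ρ` between Alice and Bob, measured by Alice with
the operators `A`, and with an arbitrary independent source between Bob and Charlie. -/
def realizableWith [DecidableEq hB] (ρ : Matrix (hA × hB) (hA × hB) ℂ)
    (A : Bit → Bit → Matrix hA hA ℂ) : Set Corr :=
  {p | ∃ (hB' hC : Type) (_ : Fintype hB') (_ : Fintype hC) (_ : DecidableEq hB')
      (_ : DecidableEq hC)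
      (σ : Matrix (hB' × hC) (hB' × hC) ℂ) (B : Bit → Matrix (hB × hB') (hB × hB') ℂ)
      (C : Bit → Bit → Matrix hC hC ℂ),
      IsState σ ∧ IsPOVM B ∧ (∀ z, IsPOVM fun c => C c z) ∧ p = bornCorr ρ σ A B C}

variable [DecidableEq hB] {ρ : Matrix (hA × hB) (hA × hB) ℂ}
  {A : Bit → Bit → Matrix hA hA ℂ}

lemma realizableWith_subset_Q2 [DecidableEq hA] (hρ : IsState ρ)
    (hAM : ∀ x, IsPOVM fun a => A a x) : realizableWith ρ A ⊆ Q2 := by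
  rintro _ ⟨_, _, _, _, _, _, σ, B, C, hσ, hBM, hCM, rfl⟩
  exact ⟨_, _, _, _, _, _, _, _, _, _, _, _, ρ, σ, A, B, C, hρ, hσ, hAM, hBM, hCM, rfl⟩

/-- Charlie's source may carry a flag saying which of two models to run. -/
lemma convex_realizableWith : Convex ℝ (realizableWith ρ A) := by
  rintro _ ⟨hB', hC, _, _, _, _, σ, B, C, hσ, hBM, hCM, rfl⟩
    _ ⟨kB, kC, _, _, _, _, τ, B', C', hτ, hBM', hCM', rfl⟩ s t hs ht hst
  have hinl : (Prod.map Sum.inl Sum.inl : hB' × hC → (hB' ⊕ kB) × (hC ⊕ kC)).Injective :=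
    Sum.inl_injective.prodMap Sum.inl_injective
  have hinr : (Prod.map Sum.inr Sum.inr : kB × kC → (hB' ⊕ kB) × (hC ⊕ kC)).Injective :=
    Sum.inr_injective.prodMap Sum.inr_injective
  refine ⟨_, _, _, _, _, _,
    s • zeroExtend (Prod.map Sum.inl Sum.inl) σ + t • zeroExtend (Prod.map Sum.inr Sum.inr) τ,
    fun b => (fromBlocks (B b) 0 0 (B' b)).submatrix (Equiv.prodSumDistrib ..)
      (Equiv.prodSumDistrib ..),
    fun c z => fromBlocks (C c z) 0 0 (C' c z),
    (hσ.zeroExtend hinl).convexComb (hτ.zeroExtend hinr) hs ht hst,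
    isPOVM_submatrix (isPOVM_fromBlocks hBM hBM') _,
    fun z => isPOVM_fromBlocks (hCM z) (hCM' z), ?_⟩
  rw [bornCorr_convexComb, bornCorr_zeroExtend, bornCorr_zeroExtend]
  rfl

end SourceMixture

section PhiPlus

lemma one_div_sqrt_two_mul_self : 1 / √2 * (1 / √2) = (1 / 2 : ℝ) := by
  rw [div_mul_div_comm, Real.mul_self_sqrt zero_le_two, one_mul]

lemma ofReal_one_div_sqrt_two_mul_self : ((1 / √2 : ℝ) : ℂ) * ((1 / √2 : ℝ) : ℂ) = 1 / 2 := by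
  rw [← Complex.ofReal_mul, one_div_sqrt_two_mul_self, Complex.ofReal_div, Complex.ofReal_one,
    Complex.ofReal_ofNat]

lemma ketbra_phiPlus_apply (i j : Bit × Bit) :
    ketbra phiPlus i j = if i.1 = i.2 then if j.1 = j.2 then 1 / 2 else 0 else 0 := by
  rw [ketbra, vecMulVec_apply, phiPlus, Pi.star_apply, phiPlus, apply_ite star, star_zero,
    RCLike.star_def, Complex.conj_ofReal]
  simp only [mul_ite, ite_mul, ofReal_one_div_sqrt_two_mul_self, zero_mul, mul_zero]
  split_ifs <;> rfl

lemma dotProduct_star_phiPlus : phiPlus ⬝ᵥ star phiPlus = 1 := by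
  rw [← trace_vecMulVec, ← ketbra]
  simp [trace, ketbra_phiPlus_apply, Fintype.sum_prod_type]

lemma dotProduct_star_psiPlus : psiPlus ⬝ᵥ star psiPlus = 1 := by
  have h := ofReal_one_div_sqrt_two_mul_self
  simp only [dotProduct, psiPlus, Pi.star_apply, Fintype.sum_prod_type, Fin.sum_univ_two,
    apply_ite star, star_zero, RCLike.star_def, Complex.conj_ofReal]
  simp only [h, if_true, if_false, zero_ne_one, one_ne_zero, mul_zero]
  norm_num

lemma dotProduct_star_psiTheta (θ : ℝ) : psiTheta θ ⬝ᵥ star (psiTheta θ) = 1 := by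
  have h : (Real.sin θ : ℂ) * Real.sin θ + Real.cos θ * Real.cos θ = 1 := by
    exact_mod_cast (by nlinarith [Real.sin_sq_add_cos_sq θ] :
      Real.sin θ * Real.sin θ + Real.cos θ * Real.cos θ = 1)
  simp only [dotProduct, psiTheta, Pi.star_apply, Fintype.sum_prod_type, Fin.sum_univ_two,
    apply_ite star, RCLike.star_def, Complex.conj_ofReal]
  simpa [-Complex.ofReal_sin, -Complex.ofReal_cos] using h

lemma isPOVM_obsProj_obsXZ (x : Bit) : IsPOVM (obsProj (obsXZ x)) := by
  refine isPOVM_obsProj ?_ ?_ <;> ext i j <;> fin_cases x <;> fin_cases i <;> fin_cases j <;>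
    simp [obsXZ, sigmaX, sigmaZ]

lemma isPOVM_obsProj_obsDiag (x : Bit) : IsPOVM (obsProj (obsDiag x)) := by
  have h := ofReal_one_div_sqrt_two_mul_self
  refine isPOVM_obsProj ?_ ?_
  · ext i j
    fin_cases x <;> fin_cases i <;> fin_cases j <;> simp [obsDiag, sigmaX, sigmaZ]
  · rw [obsDiag, smul_mul_smul_comm, h]
    ext i j
    fin_cases x <;> fin_cases i <;> fin_cases j <;>
      simp [sigmaX, sigmaZ] <;> norm_num

lemma trace_obsProj {O : Matrix Bit Bit ℂ} (h : O.trace = 0) (o : Bit) :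
    (obsProj O o).trace = 1 := by
  simp [obsProj, trace_smul, h]

lemma trace_obsXZ (x : Bit) : (obsXZ x).trace = 0 := by
  fin_cases x <;> simp [obsXZ, sigmaX, sigmaZ, trace_fin_two]

lemma trace_obsDiag (x : Bit) : (obsDiag x).trace = 0 := by
  fin_cases x <;> simp [obsDiag, sigmaX, sigmaZ, trace_fin_two]

variable (A : Bit → Bit → Matrix Bit Bit ℂ) (B : Bit → Matrix (Bit × Bit) (Bit × Bit) ℂ)
  (C : Bit → Bit → Matrix Bit Bit ℂ)

lemma bornCorr_phiPlus (a b c x z : Bit) :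
    bornCorr (ketbra phiPlus) (ketbra phiPlus) A B C a b c x z =
      ((A a x ⊗ₖ C c z)ᵀ * B b).trace.re / 4 := by
  rw [bornCorr_eq_sum, ← Complex.div_ofNat_re]
  simp only [ketbra_phiPlus_apply, ite_mul, mul_ite, zero_mul, mul_zero, Fintype.sum_prod_type,
    sum_ite_irrel, sum_const_zero, sum_ite_eq, mem_univ, if_true, trace, diag_apply, mul_apply,
    transpose_apply, kroneckerMap_apply]
  simp only [div_eq_inv_mul, mul_sum]
  refine congrArg _ (sum_congr rfl fun i _ => ?_)
  rw [sum_comm]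
  exact sum_congr rfl fun k _ => sum_congr rfl fun j _ => sum_congr rfl fun l _ => by ring

lemma bornCorr_phiPlus_vecMeas_zero (v : Bit × Bit → ℂ) (a c x z : Bit) :
    bornCorr (ketbra phiPlus) (ketbra phiPlus) A (vecMeas v) C a 0 c x z =
      (v ⬝ᵥ (A a x ⊗ₖ C c z) *ᵥ star v).re / 4 := by
  rw [bornCorr_phiPlus, vecMeas, if_pos rfl, ketbra, mul_vecMulVec, trace_vecMulVec,
    mulVec_transpose, dotProduct_mulVec]

variable {A B C}

lemma hasUniformEnds_bornCorr_phiPlus (hA : ∀ a x, (A a x).trace = 1) (hB : ∑ b, B b = 1)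
    (hC : ∀ c z, (C c z).trace = 1) :
    HasUniformEnds (bornCorr (ketbra phiPlus) (ketbra phiPlus) A B C) := fun a c x z => by
  rw [bornCorr_phiPlus, bornCorr_phiPlus, ← add_div, ← Complex.add_re, ← trace_add, ← mul_add,
    ← Fin.sum_univ_two, hB, mul_one, trace_transpose, trace_kronecker, hA, hC, mul_one,
    Complex.one_re]

lemma pES_eq : pES = pPS (1 / √2) (1 / 4) := by
  have h := one_div_sqrt_two_mul_self
  refine (hasUniformEnds_bornCorr_phiPlus (fun a x => trace_obsProj (trace_obsDiag x) a)
    (isPOVM_vecMeas dotProduct_star_psiPlus).2 fun c z => trace_obsProj (trace_obsXZ z) c).ext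
    (hasUniformEnds_pPS _ _) fun a c x z => ?_
  rw [bornCorr_phiPlus_vecMeas_zero]
  simp only [dotProduct, mulVec, Fintype.sum_prod_type, Fin.sum_univ_two, pPS, prBox, obsProj,
    obsDiag, obsXZ]
  generalize hr : 1 / √2 = r at *
  have h3 : r * r * r = r / 2 := by rw [h]; ring
  fin_cases a <;> fin_cases c <;> fin_cases x <;> fin_cases z <;>
    simp [sigmaX, sigmaZ, psiPlus, hr, -one_div] <;> linarith

lemma pMNN2_eq (θ : ℝ) : pMNN2 θ = tilted (Real.sin θ) (Real.cos θ) := by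
  have h := Real.sin_sq_add_cos_sq θ
  refine (hasUniformEnds_bornCorr_phiPlus (fun a x => trace_obsProj (trace_obsXZ x) a)
    (isPOVM_vecMeas (dotProduct_star_psiTheta θ)).2 fun c z => trace_obsProj (trace_obsXZ z) c).ext
    (hasUniformEnds_tilted _ _) fun a c x z => ?_
  rw [bornCorr_phiPlus_vecMeas_zero]
  simp only [dotProduct, mulVec, Fintype.sum_prod_type, Fin.sum_univ_two, tilted, obsProj, obsXZ]
  unfold psiTheta
  generalize Real.sin θ = s at *
  generalize Real.cos θ = k at *
  fin_cases a <;> fin_cases c <;> fin_cases x <;> fin_cases z <;>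
    simp [sigmaX, sigmaZ] <;> linarith

lemma trace_transpose_obsProj_mul {O P : Matrix Bit Bit ℂ} (hO : O.trace = 0) (hP : P.trace = 0)
    (a b : Bit) : ((obsProj O a)ᵀ * obsProj P b).trace =
      1 / 2 + (-1) ^ (a.val + b.val) / 4 * (Oᵀ * P).trace := by
  simp only [obsProj, transpose_smul, transpose_add, transpose_one, smul_mul_smul_comm, add_mul,
    mul_add, one_mul, mul_one, trace_smul, trace_add, trace_transpose, hO, hP, trace_one,
    Fintype.card_fin, smul_eq_mul]
  ring

lemma trace_transpose_obsDiag_mul (x y : Bit) :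
    ((obsDiag x)ᵀ * obsDiag y).trace = if x = y then 2 else 0 := by
  rw [obsDiag, obsDiag, transpose_smul, smul_mul_smul_comm, ofReal_one_div_sqrt_two_mul_self]
  fin_cases x <;> fin_cases y <;> simp [sigmaX, sigmaZ, trace_fin_two, mul_apply] <;>
    norm_num

/-- The local Bell test between Alice and Bob with Bob's input fixed to `k`, which Charlie
outputs. -/
def bellTest (k : Bit) : Corr :=
  bornCorr (ketbra phiPlus) (ketbra phiPlus) (fun a x => obsProj (obsDiag x) a)
    (fun b => obsProj (obsDiag k) b ⊗ₖ 1) (fun c _ => if c = k then 1 else 0)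

lemma bellTest_apply (k a b c x z : Bit) : bellTest k a b c x z =
    if c = k then 1 / 2 * (if x = k then (if a = b then 1 else 0) else 1 / 2) else 0 := by
  rw [bellTest, bornCorr_phiPlus, ← kroneckerMap_transpose, ← mul_kronecker_mul, trace_kronecker,
    trace_transpose_obsProj_mul (trace_obsDiag x) (trace_obsDiag k), trace_transpose_obsDiag_mul]
  fin_cases a <;> fin_cases b <;> split_ifs <;> norm_num at *

lemma pL_eq_bellTest : pL = (1 / 2 : ℝ) • bellTest 0 + (1 / 2 : ℝ) • bellTest 1 := by
  ext a b c x z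
  simp only [pL, Pi.add_apply, Pi.smul_apply, bellTest_apply]
  fin_cases c <;> simp <;> split_ifs <;> norm_num

lemma bellTest_mem_realizableWith (k : Bit) :
    bellTest k ∈ realizableWith (ketbra phiPlus) fun a x => obsProj (obsDiag x) a :=
  ⟨_, _, _, _, _, _, _, _, _, isState_ketbra dotProduct_star_phiPlus,
    isPOVM_kronecker_one (isPOVM_obsProj_obsDiag k), fun _ => isPOVM_ite_eq k, rfl⟩

lemma pMNN1_mem_Q2 {μ : ℝ} (h0 : 0 ≤ μ) (h1 : μ ≤ 1) : pMNN1 μ ∈ Q2 := by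
  have hconv := convex_realizableWith (ρ := ketbra phiPlus) (A := fun a x => obsProj (obsDiag x) a)
  have hES : pES ∈ realizableWith (ketbra phiPlus) fun a x => obsProj (obsDiag x) a :=
    ⟨_, _, _, _, _, _, _, _, _, isState_ketbra dotProduct_star_phiPlus,
      isPOVM_vecMeas dotProduct_star_psiPlus, isPOVM_obsProj_obsXZ, rfl⟩
  have hL : pL ∈ realizableWith (ketbra phiPlus) fun a x => obsProj (obsDiag x) a := by
    rw [pL_eq_bellTest]
    exact hconv (bellTest_mem_realizableWith 0) (bellTest_mem_realizableWith 1) (by norm_num)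
      (by norm_num) (by norm_num)
  exact realizableWith_subset_Q2 (isState_ketbra dotProduct_star_phiPlus) isPOVM_obsProj_obsDiag
    (hconv hES hL h0 (sub_nonneg.2 h1) (add_sub_cancel _ _))

lemma pMNN2_mem_Q2 (θ : ℝ) : pMNN2 θ ∈ Q2 :=
  realizableWith_subset_Q2 (isState_ketbra dotProduct_star_phiPlus) isPOVM_obsProj_obsXZ
    ⟨_, _, _, _, _, _, _, _, _, isState_ketbra dotProduct_star_phiPlus,
      isPOVM_vecMeas (dotProduct_star_psiTheta θ), isPOVM_obsProj_obsXZ, rfl⟩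

end PhiPlus

lemma sin_ne_cos {θ : ℝ} (h0 : 0 < θ) (h1 : θ < Real.pi / 2) (h : θ ≠ Real.pi / 4) :
    Real.sin θ ≠ Real.cos θ := by
  rw [← Real.sin_pi_div_two_sub]
  intro he
  have := Real.injOn_sin ⟨by linarith, by linarith⟩ ⟨by linarith, by linarith⟩ he
  exact h (by linarith)

lemma pMNN2_mem {θ : ℝ} (h0 : 0 < θ) (h1 : θ < Real.pi / 2) (hne : θ ≠ Real.pi / 4) :
    pMNN2 θ ∈ Q2 ∩ MNN := by
  have hs : 0 < Real.sin θ := Real.sin_pos_of_pos_of_lt_pi h0 (by linarith)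
  have hc : 0 < Real.cos θ := Real.cos_pos_of_mem_Ioo ⟨by linarith, h1⟩
  have h := Real.sin_sq_add_cos_sq θ
  refine ⟨pMNN2_mem_Q2 θ, ?_⟩
  rw [pMNN2_eq]
  exact ⟨tilted_mem_S1cap hs.le hc.le h, tilted_notMem_S0 hs hc h (sin_ne_cos h0 h1 hne)⟩

lemma pMNN1_mem {μ : ℝ} (hμ : μ ∈ Set.Ioc (2 / (3 + √2)) (1 / √2)) : pMNN1 μ ∈ Q2 ∩ MNN := by
  obtain ⟨V, hV⟩ : ∃ V, 1 / √2 = V := ⟨_, rfl⟩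
  have hV2 : V * V = 1 / 2 := hV ▸ one_div_sqrt_two_mul_self
  have hV0 : 0 < V := hV ▸ by positivity
  have hVl : 0.7071 < V := by nlinarith
  have hVu : V < 0.7072 := by nlinarith
  have hs : √2 = 2 * V := by
    rw [← hV, mul_one_div, Real.div_sqrt]
  rw [hV, hs, Set.mem_Ioc, div_lt_iff₀ (by linarith)] at hμ
  obtain ⟨hl, hu⟩ := hμ
  have hμ0 : 0 < μ := pos_of_mul_pos_left (two_pos.trans hl) (by linarith)
  refine ⟨pMNN1_mem_Q2 hμ0.le (by linarith), ?_⟩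
  have hmixed : pMNN1 μ = mixed V μ := by rw [pMNN1, pES_eq, hV]; rfl
  rw [hmixed]
  refine ⟨mixed_mem_S1cap (by linarith) (by linarith) hμ0.le (by nlinarith),
    mixed_notMem_S0 hμ0 ?_ ?_⟩
  · have hl' := mul_lt_mul_of_pos_right hl (by linarith : 0 < 3 - 4 * V)
    linear_combination hl' / 2 - 5 * μ * hV2
  · -- The vertex condition holds up to about `0.63`, the discriminant condition from about `0.51`.
    rcases le_total μ 0.63 with h | h
    · exact .inl (by nlinarith)
    · exact .inr (by nlinarith)

lemma Ioo_subset_Ioc_sqrt_two : Set.Ioo (0.455 : ℝ) 0.705 ⊆ Set.Ioc (2 / (3 + √2)) (1 / √2) := by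
  have hl : 1.41 < √2 := Real.lt_sqrt_of_sq_lt (by norm_num)
  have hu : √2 < 1.415 := (Real.sqrt_lt' (by norm_num)).2 (by norm_num)
  refine fun μ hμ => ⟨lt_of_le_of_lt ?_ hμ.1, hμ.2.le.trans ?_⟩
  · rw [div_le_iff₀ (by positivity)]
    linarith
  · rw [le_div_iff₀ (by positivity)]
    linarith

end

end ThreeChain

theorem mainTheorem5 :
    (ThreeChain.Q2 ∩ ThreeChain.MNN).Nonempty ∧
    ThreeChain.pES = ThreeChain.pPS (1 / √2) (1 / 4) ∧
    (∀ μ ∈ Set.Ioo (0.455 : ℝ) 0.705, ThreeChain.pMNN1 μ ∈ ThreeChain.Q2 ∩ ThreeChain.MNN) ∧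
    (∀ θ ∈ Set.Ioo (0 : ℝ) (Real.pi / 4) ∪ Set.Ioo (Real.pi / 4) (Real.pi / 2),
      ThreeChain.pMNN2 θ ∈ ThreeChain.Q2 ∩ ThreeChain.MNN) := by
  have hμ : ∀ μ ∈ Set.Ioo (0.455 : ℝ) 0.705, ThreeChain.pMNN1 μ ∈ ThreeChain.Q2 ∩ ThreeChain.MNN :=
    fun μ h => ThreeChain.pMNN1_mem (ThreeChain.Ioo_subset_Ioc_sqrt_two h)
  refine ⟨⟨_, hμ 0.5 (by norm_num)⟩, ThreeChain.pES_eq, hμ, ?_⟩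
  rintro θ (⟨h0, h1⟩ | ⟨h0, h1⟩)
  · exact ThreeChain.pMNN2_mem h0 (by linarith [Real.pi_pos]) h1.ne
  · exact ThreeChain.pMNN2_mem (by linarith [Real.pi_pos]) h1 h0.ne'
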